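/- Conventions. A unitary multitensor category is a semisimple rigid tensor $\mathrm C^*$-category (finite-dimensional morphism spaces; orthogonal direct sums, a zero object and split projections; bilinear tensor product with $(f\otimes g)^\dagger=f^\dagger\otimes g^\dagger$; unitary associators and unitors); it is a unitary tensor category if moreover $\mathrm{End}(1)=\mathbb C\,\mathrm{id}\neq 0$. A unitary dual functor is a choice of duals $(c^\vee,\ \mathrm{ev}_c:c^\vee\otimes c\to 1,\ \mathrm{coev}_c:1\to c\otimes c^\vee)$ satisfying the zigzag identities, such that $(f^\vee)^\dagger=(f^\dagger)^\vee$ for all $f$ and the canonical isomorphisms $a^\vee\otimes b^\vee\to(b\otimes a)^\vee$ are unitary. Given one, put $\overline c:=c^\vee$ and $\overline f:=(f^\dagger)^\vee:\overline a\to\overline b$ for $f:a\to b$, let $\varphi_c:=(\mathrm{coev}_c^\dagger\otimes \mathrm{id})\circ(\mathrm{id}\otimes\mathrm{coev}_{c^\vee}):c\to c^{\vee\vee}$, and let $\mathrm{tr}_R(f):=\mathrm{coev}_c^\dagger\circ(f\otimes\mathrm{id})\circ\mathrm{coev}_c\in\mathrm{End}(1)$ for $f:c\to c$. For a monoidal functor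 $F$ let $\chi^F_c:F(\overline c)\to\overline{F(c)}$ be the canonical isomorphism $(F(\mathrm{ev}_c)\otimes\mathrm{id})\circ(\mathrm{id}\otimes\mathrm{coev}_{F(c)})$ (structure maps of $F$ suppressed); $F$ is pivotal if $(\chi^F_c)^\vee\circ\varphi_{F(c)}=\chi^F_{c^\vee}\circ F(\varphi_c)$ for all $c$. Setting. Let $\mathcal V$ be a braided unitary tensor category with a chosen unitary dual functor, and let $\mathcal C$ be a unitary module multitensor category over $\mathcal V$: a unitary multitensor category with a chosen unitary dual functor, a faithful state $\psi$ on $\mathrm{End}_{\mathcal C}(1_{\mathcal C})$, and a braided pivotal dagger tensor functor $\Phi^{\mathcal Z}$ (linear, with unitary structure maps) from $\mathcal V$ to the unitary Drinfeld centre $\mathcal Z^\dagger(\mathcal C)$, the full subcategory of the Drinfeld centre on the objects with unitary half-braidings. Let $\Phi:\mathcal V\to\mathcal C$ be the composite of $\Phi^{\mathcal Z}$ with the forgetful functor. Suppose that $\Phi$ has a unitary right adjoint $\mathbf{Tr}_{\mathcal V}:\mathcal C\to\mathcal V$, i.e. a right adjoint such that the bijections $\mathcal C(\Phi(v)\to c)\cong\mathcal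 V(v\to\mathbf{Tr}_{\mathcal V}(c))$ are unitary for the inner products $\langle f,g\rangle=\psi(\mathrm{tr}_R(g^\dagger\circ f))$ on $\mathcal C$ and $\langle f,g\rangle=\mathrm{tr}_R(g^\dagger\circ f)\in\mathrm{End}(1_{\mathcal V})\cong\mathbb C$ on $\mathcal V$. Equip $\mathbf{Tr}_{\mathcal V}$ with its lax monoidal structure as a right adjoint of a monoidal functor: with $\varepsilon$ the counit, $\mu_{c,d}:\mathbf{Tr}_{\mathcal V}(c)\otimes\mathbf{Tr}_{\mathcal V}(d)\to\mathbf{Tr}_{\mathcal V}(c\otimes d)$ is the mate of $\varepsilon_c\otimes\varepsilon_d:\Phi(\mathbf{Tr}_{\mathcal V}(c)\otimes\mathbf{Tr}_{\mathcal V}(d))\to c\otimes d$ and $i:1_{\mathcal V}\to\mathbf{Tr}_{\mathcal V}(1_{\mathcal C})$ is the mate of the canonical isomorphism $\Phi(1_{\mathcal V})\to1_{\mathcal C}$. Let $\chi_c:\mathbf{Tr}_{\mathcal V}(\overline c)\to\overline{\mathbf{Tr}_{\mathcal V}(c)}$ be the canonical involutive structure of $\mathbf{Tr}_{\mathcal V}$,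 the isomorphism whose inverse is the mate of $\overline{\varepsilon_c}\circ\chi^\Phi_{\mathbf{Tr}_{\mathcal V}(c)}:\Phi(\overline{\mathbf{Tr}_{\mathcal V}(c)})\to\overline c$. Statement. For every $c\in\mathcal C$, $$\mathrm{coev}^\dagger_{\mathbf{Tr}_{\mathcal V}(c)}=i^\dagger\circ\mathbf{Tr}_{\mathcal V}(\mathrm{coev}_c^\dagger)\circ\mu_{c,\overline c}\circ(\mathrm{id}\otimes\chi_c^{-1}):\ \mathbf{Tr}_{\mathcal V}(c)\otimes\overline{\mathbf{Tr}_{\mathcal V}(c)}\to1_{\mathcal V}.$$ Moreover the pairing $i^\dagger\circ\mathbf{Tr}_{\mathcal V}(\mathrm{coev}_c^\dagger)\circ\mu_{c,\overline c}:\mathbf{Tr}_{\mathcal V}(c)\otimes\mathbf{Tr}_{\mathcal V}(\overline c)\to1_{\mathcal V}$ is nondegenerate, i.e. there is a copairing $1_{\mathcal V}\to\mathbf{Tr}_{\mathcal V}(\overline c)\otimes\mathbf{Tr}_{\mathcal V}(c)$ which together with it satisfies both zigzag identities. -/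

import Mathlib

open CategoryTheory MonoidalCategory

universe v v₁ v₂ u u₁ u₂

noncomputable section

namespace UnitaryModule

open scoped ComplexOrder

/-! ### Semisimple C*-categories -/

/-- A dagger category: an involutive, identity-on-objects, contravariant operation on morphisms. -/
class DaggerCategory (C : Type u) [Category.{v} C] where
  dag : ∀ {X Y : C}, (X ⟶ Y) → (Y ⟶ X)
  dag_id : ∀ X : C, dag (𝟙 X) = 𝟙 X
  dag_comp : ∀ {X Y Z : C} (f : X ⟶ Y) (g : Y ⟶ Z), dag (f ≫ g) = dag g ≫ dag f
  dag_dag : ∀ {X Y : C} (f : X ⟶ Y), dag (dag f) = f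

open DaggerCategory

/-- A morphism `f` is unitary if `f†` is a two-sided inverse of `f`. -/
def IsUnitary {C : Type u} [Category.{v} C] [DaggerCategory C] {X Y : C} (f : X ⟶ Y) : Prop :=
  f ≫ dag f = 𝟙 X ∧ dag f ≫ f = 𝟙 Y

/-- A C*-norm on a `ℂ`-linear dagger category: a complete submultiplicative norm on each space of
morphisms satisfying `‖f† ∘ f‖ = ‖f‖²`. -/
structure CStarNorm (C : Type u) [Category.{v} C] [Preadditive C] [Linear ℂ C]
    [DaggerCategory C] where
  norm : ∀ X Y : C, AddGroupNorm (X ⟶ Y)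
  norm_smul : ∀ {X Y : C} (z : ℂ) (f : X ⟶ Y), norm X Y (z • f) = ‖z‖ * norm X Y f
  norm_comp_le : ∀ {X Y Z : C} (f : X ⟶ Y) (g : Y ⟶ Z),
    norm X Z (f ≫ g) ≤ norm X Y f * norm Y Z g
  norm_comp_dag : ∀ {X Y : C} (f : X ⟶ Y), norm X X (f ≫ dag f) = norm X Y f ^ 2
  complete : ∀ {X Y : C} (s : ℕ → (X ⟶ Y)),
    (∀ e : ℝ, 0 < e → ∃ N, ∀ m n, N ≤ m → N ≤ n → norm X Y (s m - s n) < e) →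
      ∃ f, ∀ e : ℝ, 0 < e → ∃ N, ∀ n, N ≤ n → norm X Y (s n - f) < e

/-- A C*-category: a `ℂ`-linear dagger category with conjugate-linear dagger, whose morphism spaces
carry a (necessarily unique) C*-norm, and in which every `f† ∘ f` is a positive element of the
endomorphism algebra of the source of `f`. -/
class CStarCategory (C : Type u) [Category.{v} C] [Preadditive C] [Linear ℂ C]
    [DaggerCategory C] : Prop where
  dag_add : ∀ {X Y : C} (f g : X ⟶ Y), dag (f + g) = dag f + dag g
  dag_smul : ∀ {X Y : C} (z : ℂ) (f : X ⟶ Y), dag (z • f) = (starRingEnd ℂ z) • dag f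
  nonempty_norm : Nonempty (CStarNorm C)
  exists_positive : ∀ {X Y : C} (f : X ⟶ Y), ∃ g : X ⟶ X, f ≫ dag f = g ≫ dag g

/-- A semisimple C*-category: a C*-category with finite-dimensional morphism spaces which is Cauchy
complete (it has a zero object and orthogonal direct sums, and all projections split). -/
class SemisimpleCStarCategory (C : Type u) [Category.{v} C] [Preadditive C] [Linear ℂ C]
    [DaggerCategory C] : Prop extends CStarCategory C where
  finite_hom : ∀ X Y : C, Module.Finite ℂ (X ⟶ Y)
  exists_zero : ∃ Z : C, 𝟙 Z = 0
  exists_sum : ∀ X Y : C, ∃ (Z : C) (i : X ⟶ Z) (j : Y ⟶ Z),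
    i ≫ dag i = 𝟙 X ∧ j ≫ dag j = 𝟙 Y ∧ i ≫ dag j = 0 ∧ dag i ≫ i + dag j ≫ j = 𝟙 Z
  exists_split : ∀ (X : C) (p : X ⟶ X), p ≫ p = p → dag p = p →
    ∃ (Y : C) (i : Y ⟶ X), i ≫ dag i = 𝟙 Y ∧ dag i ≫ i = p

/-! ### Unitary multitensor categories and unitary dual functors -/

/-- A semisimple tensor C*-category: the tensor product is bilinear and compatible with the dagger,
and the associators and unitors are unitary. -/
class SemisimpleTensorCStarCategory (C : Type u) [Category.{v} C] [Preadditive C] [Linear ℂ C]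
    [MonoidalCategory C] [MonoidalPreadditive C] [MonoidalLinear ℂ C] [DaggerCategory C] :
    Prop extends SemisimpleCStarCategory C where
  dag_tensor : ∀ {X₁ Y₁ X₂ Y₂ : C} (f : X₁ ⟶ Y₁) (g : X₂ ⟶ Y₂),
    dag (f ⊗ₘ g) = dag f ⊗ₘ dag g
  unitary_associator : ∀ X Y Z : C, IsUnitary (α_ X Y Z).hom
  unitary_leftUnitor : ∀ X : C, IsUnitary (λ_ X).hom
  unitary_rightUnitor : ∀ X : C, IsUnitary (ρ_ X).hom

section Duals

variable {C : Type u} [Category.{v} C] [MonoidalCategory C] [RightRigidCategory C]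

/-- The chosen coevaluation `coev_c : 1 ⟶ c ⊗ c^∨`. -/
def coev (c : C) : 𝟙_ C ⟶ c ⊗ cᘁ := ExactPairing.coevaluation c cᘁ

/-- The canonical isomorphism `ν_{a,b} : a^∨ ⊗ b^∨ ≅ (b ⊗ a)^∨`. -/
def dualTensor (a b : C) : aᘁ ⊗ bᘁ ≅ (b ⊗ a)ᘁ :=
  (rightDualTensorIso b a).symm

variable [DaggerCategory C]

/-- The canonical morphism `φ_c = (coev_c† ⊗ 1) ∘ (1 ⊗ coev_{c^∨}) : c ⟶ c^∨∨`. -/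
def pivotalMap (c : C) : c ⟶ (cᘁ)ᘁ :=
  (ρ_ c).inv ≫ c ◁ coev (cᘁ) ≫ (α_ c (cᘁ) ((cᘁ)ᘁ)).inv ≫ dag (coev c) ▷ (cᘁ)ᘁ ≫ (λ_ _).hom

/-- The action on morphisms of the canonical involutive structure, with `c̄ = c^∨` on objects:
`f̄ = (f†)^∨ : X^∨ ⟶ Y^∨` for `f : X ⟶ Y`. -/
def barMap {X Y : C} (f : X ⟶ Y) : Xᘁ ⟶ Yᘁ := (dag f)ᘁ

/-- The right pivotal trace `coev_c† ∘ (f ⊗ 1) ∘ coev_c`, with values in `End(1)`. -/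
def rightTrace {c : C} (f : c ⟶ c) : 𝟙_ C ⟶ 𝟙_ C := coev c ≫ f ▷ cᘁ ≫ dag (coev c)

/-- The form `⟨f, g⟩ = ω (tr_R (g† ∘ f))` on `Hom(a, b)` attached to a functional `ω` on
`End(1)`. -/
def homInner [Preadditive C] [Linear ℂ C] (ω : (𝟙_ C ⟶ 𝟙_ C) →ₗ[ℂ] ℂ) {a b : C} (f g : a ⟶ b) :
    ℂ :=
  ω (rightTrace (f ≫ dag g))

end Duals

/-- The chosen duals `(c^∨, ev_c, coev_c)` of a semisimple tensor C*-category form a unitary dual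
functor: `c ↦ c^∨` commutes with the dagger and `ν_{a,b}` is unitary. A category of this class is a
unitary multitensor category (that is, a semisimple rigid tensor C*-category) with a chosen unitary
dual functor. -/
class UnitaryMultitensorCategory (C : Type u) [Category.{v} C] [Preadditive C] [Linear ℂ C]
    [MonoidalCategory C] [MonoidalPreadditive C] [MonoidalLinear ℂ C] [DaggerCategory C]
    [RightRigidCategory C] : Prop extends SemisimpleTensorCStarCategory C where
  dag_mate : ∀ {X Y : C} (f : X ⟶ Y), dag (fᘁ) = (dag f)ᘁ
  unitary_dualTensor : ∀ a b : C, IsUnitary (dualTensor a b).hom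

section DualLemmas

set_option linter.unusedSectionVars false

variable {C : Type u} [Category.{v} C] [Preadditive C] [Linear ℂ C]
    [MonoidalCategory C] [MonoidalPreadditive C] [MonoidalLinear ℂ C] [DaggerCategory C]
    [RightRigidCategory C]

theorem mate_bijective (X Y : C) : Function.Bijective (fun f : X ⟶ Y => fᘁ) := by
  let E : (X ⟶ Y) ≃ (Yᘁ ⟶ Xᘁ) :=
    ((λ_ X).symm.homFromEquiv).trans <|
      (tensorRightHomEquiv (𝟙_ C) X (Xᘁ) Y).trans <|
        (tensorLeftHomEquiv (𝟙_ C) Y (Yᘁ) (Xᘁ)).symm.trans (ρ_ (Yᘁ)).homFromEquiv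
  have h : (fun f : X ⟶ Y => fᘁ) = E := by
    funext f
    have h1 : tensorRightHomEquiv (𝟙_ C) X (Xᘁ) Y ((λ_ X).hom ≫ f) =
        ExactPairing.coevaluation X (Xᘁ) ≫ f ▷ (Xᘁ) := by
      rw [← tensorRightHomEquiv_symm_coevaluation_comp_whiskerRight (Y := X) (Y' := Xᘁ) f, Equiv.apply_symm_apply]
    have h2 : E f = (ρ_ (Yᘁ)).inv ≫ (tensorLeftHomEquiv (𝟙_ C) Y (Yᘁ) (Xᘁ)).symm
        (tensorRightHomEquiv (𝟙_ C) X (Xᘁ) Y ((λ_ X).hom ≫ f)) := rfl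
    rw [h2, h1, tensorLeftHomEquiv_symm_coevaluation_comp_whiskerRight, Iso.inv_hom_id_assoc]
  rw [h]
  exact E.bijective

theorem barMap_bijective (X Y : C) : Function.Bijective (fun f : X ⟶ Y => barMap f) :=
  (mate_bijective Y X).comp ⟨fun f g h => by rw [← dag_dag f, ← dag_dag g]; exact congrArg dag h,
    fun f => ⟨dag f, dag_dag f⟩⟩

theorem barMap_comp {X Y Z : C} (f : X ⟶ Y) (g : Y ⟶ Z) :
    barMap (f ≫ g) = barMap f ≫ barMap g := by
  simp only [barMap, dag_comp, comp_rightAdjointMate]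

variable [UnitaryMultitensorCategory C]

theorem IsUnitary.dag_eq {X Y : C} (e : X ≅ Y) (h : IsUnitary e.hom) : dag e.hom = e.inv := by
  rw [← cancel_mono e.hom, h.2, e.inv_hom_id]

theorem dag_whiskerRight {X Y : C} (f : X ⟶ Y) (Z : C) : dag (f ▷ Z) = dag f ▷ Z := by
  rw [← tensorHom_id, SemisimpleTensorCStarCategory.dag_tensor, dag_id, tensorHom_id]

theorem dag_whiskerLeft {X Y : C} (f : X ⟶ Y) (Z : C) : dag (Z ◁ f) = Z ◁ dag f := by
  rw [← id_tensorHom, SemisimpleTensorCStarCategory.dag_tensor, dag_id, id_tensorHom]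

theorem dag_inv {X Y : C} (e : X ≅ Y) (h : IsUnitary e.hom) : dag e.inv = e.hom := by
  rw [← IsUnitary.dag_eq e h, dag_dag]

/-- In a unitary multitensor category, `c` is dual to `c^∨` through `ev_c†` and `coev_c†`. -/
@[reducible]
def dagExactPairing (c : C) : ExactPairing (cᘁ) c where
  coevaluation' := dag (ExactPairing.evaluation c (cᘁ))
  evaluation' := dag (ExactPairing.coevaluation c (cᘁ))
  coevaluation_evaluation' := by
    have h := congrArg dag (ExactPairing.evaluation_coevaluation c (cᘁ))
    simpa only [dag_comp, dag_whiskerLeft, dag_whiskerRight, Category.assoc,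
      IsUnitary.dag_eq _ (SemisimpleTensorCStarCategory.unitary_associator _ _ _),
      IsUnitary.dag_eq _ (SemisimpleTensorCStarCategory.unitary_leftUnitor _),
      dag_inv _ (SemisimpleTensorCStarCategory.unitary_rightUnitor _)] using h
  evaluation_coevaluation' := by
    have h := congrArg dag (ExactPairing.coevaluation_evaluation c (cᘁ))
    simpa only [dag_comp, dag_whiskerLeft, dag_whiskerRight, Category.assoc,
      dag_inv _ (SemisimpleTensorCStarCategory.unitary_associator _ _ _),
      IsUnitary.dag_eq _ (SemisimpleTensorCStarCategory.unitary_rightUnitor _),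
      dag_inv _ (SemisimpleTensorCStarCategory.unitary_leftUnitor _)] using h

theorem nonempty_iso_doubleDual (c : C) : Nonempty (c ≅ (cᘁ)ᘁ) :=
  ⟨rightDualIso (dagExactPairing c) HasRightDual.exact⟩

end DualLemmas

/-- The unit object is simple: `End(1) = ℂ · id`, and `id ≠ 0`. -/
class SimpleUnit (C : Type u) [Category.{v} C] [Preadditive C] [Linear ℂ C]
    [MonoidalCategory C] : Prop where
  bijective : Function.Bijective (LinearMap.toSpanSingleton ℂ (𝟙_ C ⟶ 𝟙_ C) (𝟙 (𝟙_ C)))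

/-- The identification `End(1) ≅ ℂ` in a category with simple unit. -/
def unitScalar (C : Type u) [Category.{v} C] [Preadditive C] [Linear ℂ C]
    [MonoidalCategory C] [SimpleUnit C] : (𝟙_ C ⟶ 𝟙_ C) →ₗ[ℂ] ℂ :=
  (LinearEquiv.ofBijective _ (SimpleUnit.bijective (C := C))).symm.toLinearMap

/-- A faithful state on `End(1)`. -/
structure IsFaithfulState {C : Type u} [Category.{v} C] [Preadditive C] [Linear ℂ C]
    [MonoidalCategory C] [DaggerCategory C] (ψ : (𝟙_ C ⟶ 𝟙_ C) →ₗ[ℂ] ℂ) : Prop where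
  map_id : ψ (𝟙 (𝟙_ C)) = 1
  nonneg : ∀ f : 𝟙_ C ⟶ 𝟙_ C, 0 ≤ ψ (f ≫ dag f)
  faithful : ∀ f : 𝟙_ C ⟶ 𝟙_ C, ψ (f ≫ dag f) = 0 → f = 0

/-! ### Monoidal functors and duals -/

section Functors

set_option linter.unusedSectionVars false

variable {V : Type u₁} [Category.{v₁} V] [MonoidalCategory V]
  {C : Type u₂} [Category.{v₂} C] [MonoidalCategory C]

open Functor.LaxMonoidal Functor.OplaxMonoidal Functor.Monoidal

/-- A monoidal functor maps dual pairs to dual pairs. -/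
@[reducible]
def mapExactPairing (F : V ⥤ C) [F.Monoidal] (X Y : V) [ExactPairing X Y] :
    ExactPairing (F.obj X) (F.obj Y) where
  coevaluation' := ε F ≫ F.map (ExactPairing.coevaluation X Y) ≫ δ F X Y
  evaluation' := μ F Y X ≫ F.map (ExactPairing.evaluation X Y) ≫ η F
  coevaluation_evaluation' := by
    have h := congrArg F.map (ExactPairing.coevaluation_evaluation X Y)
    simp only [Functor.map_comp, map_whiskerLeft, map_whiskerRight, map_associator_inv,
      Category.assoc, map_leftUnitor_inv, map_rightUnitor, μ_δ_assoc, cancel_epi] at h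
    have h2 := congrArg (fun t => F.obj Y ◁ ε F ≫ t ≫ δ F _ _ ≫ η F ▷ F.obj Y) h
    simp only [Category.assoc, μ_δ_assoc, whiskerRight_ε_η, whiskerLeft_ε_η_assoc,
      Category.comp_id] at h2
    simpa only [comp_whiskerRight, MonoidalCategory.whiskerLeft_comp, Category.assoc] using h2
  evaluation_coevaluation' := by
    have h := congrArg F.map (ExactPairing.evaluation_coevaluation X Y)
    simp only [Functor.map_comp, map_whiskerLeft, map_whiskerRight, map_associator,
      Category.assoc, map_leftUnitor, map_rightUnitor_inv, μ_δ_assoc, cancel_epi] at h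
    have h2 := congrArg (fun t => ε F ▷ F.obj X ≫ t ≫ δ F _ _ ≫ F.obj X ◁ η F) h
    simp only [Category.assoc, μ_δ_assoc, whiskerLeft_ε_η, whiskerRight_ε_η_assoc,
      Category.comp_id] at h2
    simpa only [comp_whiskerRight, MonoidalCategory.whiskerLeft_comp, Category.assoc] using h2

variable [RightRigidCategory V] [RightRigidCategory C]

/-- The dual `F(c^∨)` of `F(c)`. -/
@[reducible]
def mapRightDual (F : V ⥤ C) [F.Monoidal] (c : V) : HasRightDual (F.obj c) :=
  @HasRightDual.mk _ _ _ _ (F.obj (cᘁ)) (mapExactPairing F c (cᘁ))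

/-- The canonical isomorphism `χ_c : F(c^∨) ≅ F(c)^∨` of a monoidal functor; see `chi_hom`. -/
def chi (F : V ⥤ C) [F.Monoidal] (c : V) : F.obj (cᘁ) ≅ (F.obj c)ᘁ :=
  rightDualIso (mapExactPairing F c (cᘁ)) HasRightDual.exact

/-- `χ_c = (F(ev_c) ⊗ 1) ∘ (1 ⊗ coev_{F(c)})`, up to the structure morphisms of `F`. -/
theorem chi_hom (F : V ⥤ C) [F.Monoidal] (c : V) :
    (chi F c).hom = (ρ_ _).inv ≫ F.obj (cᘁ) ◁ coev (F.obj c) ≫ (α_ _ _ _).inv ≫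
      (μ F (cᘁ) c ≫ F.map (ExactPairing.evaluation c (cᘁ)) ≫ η F) ▷ (F.obj c)ᘁ ≫ (λ_ _).hom := by
  simp only [chi, rightDualIso, rightAdjointMate, coev, id_whiskerRight,
    MonoidalCategory.whiskerLeft_id, Category.id_comp]
  rfl

/-- A monoidal functor is pivotal if `(χ_c)^∨ ∘ φ_{F(c)} = χ_{c^∨} ∘ F(φ_c)`. -/
def IsPivotal [DaggerCategory V] [DaggerCategory C] (F : V ⥤ C) [F.Monoidal] : Prop :=
  ∀ c : V, pivotalMap (F.obj c) ≫ ((chi F c).hom)ᘁ = F.map (pivotalMap c) ≫ (chi F (cᘁ)).hom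

theorem map_mate (F : V ⥤ C) [F.Monoidal] {X Y : V} (f : X ⟶ Y) :
    F.map (fᘁ) = @rightAdjointMate C _ _ _ _ (mapRightDual F X) (mapRightDual F Y) (F.map f) := by
  change _ = (ρ_ _).inv ≫ F.obj (Yᘁ) ◁ (ε F ≫ F.map (ExactPairing.coevaluation X (Xᘁ)) ≫ δ F _ _) ≫
    F.obj (Yᘁ) ◁ F.map f ▷ F.obj (Xᘁ) ≫ (α_ _ _ _).inv ≫
    (μ F _ _ ≫ F.map (ExactPairing.evaluation Y (Yᘁ)) ≫ η F) ▷ F.obj (Xᘁ) ≫ (λ_ _).hom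
  simp only [rightAdjointMate, Functor.map_comp, map_whiskerLeft, map_whiskerRight,
    map_associator_inv, map_leftUnitor, map_rightUnitor_inv, Category.assoc, μ_δ_assoc,
    comp_whiskerRight, MonoidalCategory.whiskerLeft_comp]
  rw [← MonoidalCategory.whiskerLeft_comp_assoc _ (μ F Y _), μ_δ,
    MonoidalCategory.whiskerLeft_id, Category.id_comp]

theorem chi_naturality (F : V ⥤ C) [F.Monoidal] {X Y : V} (f : X ⟶ Y) :
    F.map (fᘁ) ≫ (chi F X).hom = (chi F Y).hom ≫ (F.map f)ᘁ := by
  rw [map_mate]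
  have h1 := @comp_rightAdjointMate C _ _ _ _ _ (RightRigidCategory.rightDual _)
    (mapRightDual F X) (mapRightDual F Y) (𝟙 (F.obj X)) (F.map f)
  have h2 := @comp_rightAdjointMate C _ _ _ _ _ (RightRigidCategory.rightDual _)
    (RightRigidCategory.rightDual _) (mapRightDual F Y) (F.map f) (𝟙 (F.obj Y))
  rw [Category.id_comp] at h1
  rw [Category.comp_id] at h2
  exact h1.symm.trans h2

end Functors

/-! ### Unitary module multitensor categories -/

section Module

set_option linter.unusedSectionVars false

variable (V : Type u₁) [Category.{v₁} V] [Preadditive V] [Linear ℂ V] [MonoidalCategory V]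
  [MonoidalPreadditive V] [MonoidalLinear ℂ V] [BraidedCategory V] [DaggerCategory V]
  [RightRigidCategory V] [UnitaryMultitensorCategory V] [SimpleUnit V]
  (C : Type u₂) [Category.{v₂} C] [Preadditive C] [Linear ℂ C] [MonoidalCategory C]
  [MonoidalPreadditive C] [MonoidalLinear ℂ C] [DaggerCategory C]
  [RightRigidCategory C] [UnitaryMultitensorCategory C]

/-- The structure of a unitary module multitensor category over the braided unitary tensor category
`V` (with its chosen unitary dual functor) on the unitary multitensor category `C` (with its chosen
unitary dual functor): a faithful state on `End(1_C)` and a braided pivotal dagger tensor functor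
from `V` to the unitary Drinfeld centre of `C`, that is, to the full subcategory of the Drinfeld
centre on the objects with unitary half-braidings. Linearity, the dagger, the duals and
unitarity in the unitary Drinfeld centre are those of the underlying objects and morphisms
of `C`. -/
structure ModuleStructure where
  action : V ⥤ Center C
  braided : action.Braided
  unitary_halfBraiding : ∀ (x : V) (c : C), IsUnitary ((action.obj x).2.β c).hom
  additive : (action ⋙ Center.forget C).Additive
  linear : (action ⋙ Center.forget C).Linear ℂ
  map_dag : ∀ {x y : V} (f : x ⟶ y), (action.map (dag f)).f = dag (action.map f).f
  unitary_tensorator : ∀ x y : V, IsUnitary (Functor.LaxMonoidal.μ action x y).f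
  unitary_unit : IsUnitary (Functor.LaxMonoidal.ε action).f
  pivotal : IsPivotal (action ⋙ Center.forget C)
  state : (𝟙_ C ⟶ 𝟙_ C) →ₗ[ℂ] ℂ
  faithfulState : IsFaithfulState state

attribute [instance] ModuleStructure.braided

variable {V C}
variable (M : ModuleStructure V C)

/-- The functor `Φ : V ⥤ C`, the composite of the action with the forgetful functor. -/
def ModuleStructure.Φ : V ⥤ C := M.action ⋙ Center.forget C

instance : M.Φ.Monoidal := inferInstanceAs (M.action ⋙ Center.forget C).Monoidal

variable {T : C ⥤ V} (adj : M.Φ ⊣ T)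

/-- The adjunction `Φ ⊣ T` is unitary: its bijections `Hom(Φ(x), c) ≅ Hom(x, T(c))` preserve the
inner products given by the unitary traces `ψ ∘ tr_R` on `C` and `tr_R` on `V`. -/
def IsUnitaryAdjunction : Prop :=
  ∀ (x : V) (c : C) (f g : M.Φ.obj x ⟶ c),
    homInner (unitScalar V) (adj.homEquiv x c f) (adj.homEquiv x c g) = homInner M.state f g

/-- The unit map `i : 1_V ⟶ T(1_C)` of the lax monoidal structure of the right adjoint. -/
def traceUnit : 𝟙_ V ⟶ T.obj (𝟙_ C) :=
  letI := adj.rightAdjointLaxMonoidal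
  Functor.LaxMonoidal.ε T

/-- The multiplication map `μ_{c,d} : T(c) ⊗ T(d) ⟶ T(c ⊗ d)` of the lax monoidal structure of the
right adjoint: the mate of `ε_c ⊗ ε_d`, where `ε` is the counit. -/
def traceMul (c d : C) : T.obj c ⊗ T.obj d ⟶ T.obj (c ⊗ d) :=
  letI := adj.rightAdjointLaxMonoidal
  Functor.LaxMonoidal.μ T c d

/-- The morphism from the conjugate of `T(c)` to `T(c̄)` which is the mate of the composite of
`χ^Φ_{T(c)}` with the conjugate of the counit `ε_c : Φ(T(c)) ⟶ c`. -/
def traceChiInv (c : C) : (T.obj c)ᘁ ⟶ T.obj (cᘁ) :=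
  adj.homEquiv _ _ ((chi M.Φ (T.obj c)).hom ≫ barMap (adj.counit.app c))

theorem barMap_comp_traceChiInv {x : V} {c : C} (k : x ⟶ T.obj c) :
    barMap k ≫ traceChiInv M adj c =
      adj.homEquiv _ _ ((chi M.Φ x).hom ≫ barMap ((adj.homEquiv _ _).symm k)) := by
  have hd : M.Φ.map (dag k) = dag (M.Φ.map k) := M.map_dag k
  have hk : M.Φ.map (barMap k) ≫ (chi M.Φ (T.obj c)).hom =
      (chi M.Φ x).hom ≫ barMap (M.Φ.map k) := by
    rw [barMap, chi_naturality, hd, barMap]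
  rw [traceChiInv, ← adj.homEquiv_naturality_left, reassoc_of% hk, ← barMap_comp,
    adj.homEquiv_counit]

instance isIso_traceChiInv (c : C) : IsIso (traceChiInv M adj c) := by
  have key : ∀ x : V, Function.Bijective
      (fun k : xᘁ ⟶ (T.obj c)ᘁ => k ≫ traceChiInv M adj c) := by
    intro x
    have h : Function.Bijective
        ((fun k : xᘁ ⟶ (T.obj c)ᘁ => k ≫ traceChiInv M adj c) ∘
          (fun k : x ⟶ T.obj c => barMap k)) := by
      have h2 : ((fun k : xᘁ ⟶ (T.obj c)ᘁ => k ≫ traceChiInv M adj c) ∘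
          (fun k : x ⟶ T.obj c => barMap k)) =
          (adj.homEquiv _ _) ∘ ((chi M.Φ x).symm.homFromEquiv) ∘
            (fun f : M.Φ.obj x ⟶ c => barMap f) ∘ (adj.homEquiv _ _).symm := by
        funext k
        exact barMap_comp_traceChiInv M adj k
      rw [h2]
      exact (Equiv.bijective _).comp ((Equiv.bijective _).comp
        ((barMap_bijective _ _).comp (Equiv.bijective _)))
    exact (Function.Bijective.of_comp_iff _ (barMap_bijective x (T.obj c))).1 h
  refine isIso_of_yoneda_map_bijective _ fun x => ?_
  obtain ⟨e⟩ := nonempty_iso_doubleDual x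
  have h : (fun k : x ⟶ (T.obj c)ᘁ => k ≫ traceChiInv M adj c) =
      (e.symm.homFromEquiv) ∘ (fun k : (xᘁ)ᘁ ⟶ (T.obj c)ᘁ => k ≫ traceChiInv M adj c) ∘
        (e.homFromEquiv) := by
    funext k
    simp [Iso.homFromEquiv]
  rw [h]
  exact (Equiv.bijective _).comp ((key (xᘁ)).comp (Equiv.bijective _))

/-- The canonical involutive structure `χ^T_c`, from `T(c̄)` to the conjugate of `T(c)`, of the right
adjoint of `Φ`; its inverse is the mate `traceChiInv`. -/
def traceChi (c : C) : T.obj (cᘁ) ≅ (T.obj c)ᘁ := (asIso (traceChiInv M adj c)).symm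

end Module

/-- A pairing `p : X ⊗ Y ⟶ 1` is nondegenerate if it exhibits `X` as a dual of `Y`: there is a
copairing `1 ⟶ Y ⊗ X` which together with `p` satisfies both zigzag identities. -/
def IsNondegeneratePairing {V : Type u} [Category.{v} V] [MonoidalCategory V] {X Y : V}
    (p : X ⊗ Y ⟶ 𝟙_ V) : Prop :=
  ∃ q : 𝟙_ V ⟶ Y ⊗ X,
    X ◁ q ≫ (α_ X Y X).inv ≫ p ▷ X = (ρ_ X).hom ≫ (λ_ X).inv ∧
    q ▷ Y ≫ (α_ Y X Y).hom ≫ Y ◁ p = (λ_ Y).hom ≫ (ρ_ Y).inv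

end UnitaryModule

end

/-!
Both sides of the first identity are functionals on `T(c) ⊗ T(c)^∨` with values in `1`. In a
C*-category such functionals are separated by the morphisms `1 ⟶ T(c) ⊗ T(c)^∨`
(`eq_of_forall_comp_eq`), and by duality these are the morphisms `(k ⊗ 1) ∘ coev` with `k` an
endomorphism of `T(c)` (`exists_coev_comp_whiskerRight`). Since `End(1_V) = ℂ`, it is enough to
compare scalars.

The functional `coev†` gives `tr_R(k)`, the inner product `⟨k, 𝟙⟩` in `V`; unitarity of the
adjunction turns it into `⟨f, ε_c⟩ = ψ(tr_R(ε_c† ∘ f))`, where `f : Φ(T(c)) ⟶ c` is the mate of `k`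
and `ε_c` is that of the identity. The other functional gives the scalar of `i† ∘ q'` for some
`q' : 1 ⟶ T(1_C)`; as `i` is the mate of a unitary, this equals `ψ` of the mate of `q'`
(`unitScalar_comp_dag_traceUnit`). The definitions of `μ` and of `χ` as mates give
the mate of `q'` as `coev_c† ∘ (f ⊗ ε̄_c) ∘ coev_{Φ(T(c))}`, and moving `ε̄_c = (ε_c†)^∨` across
`coev_c†` leaves `tr_R(ε_c† ∘ f)` (`unit_comp_homEquiv_symm_eq_rightTrace`).

The comparison for `i` uses that `tr_R` is tracial and is the identity on `End(1)`. The latter holds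
because the dimension of the unit object is invertible and, by unitarity of the isomorphisms
`a^∨ ⊗ b^∨ ≅ (b ⊗ a)^∨`, idempotent (`coev_unit_comp_dag`).

The second assertion follows from the first: `coev†` is the evaluation of a dual pair, with
copairing `ev†`, and precomposition with the isomorphism `χ_c` preserves nondegeneracy.
-/

namespace UnitaryModule

open DaggerCategory

/-! ### Canonical isomorphisms between duals -/

section Duals

variable {C : Type u} [Category.{v} C] [MonoidalCategory C]

/-- The canonical isomorphism between two duals of `X` intertwines their coevaluations. -/
theorem coevaluation_comp_rightDualIso_hom {X Y₁ Y₂ : C} (p₁ : ExactPairing X Y₁)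
    (p₂ : ExactPairing X Y₂) :
    p₁.coevaluation' ≫ X ◁ (rightDualIso p₁ p₂).hom = p₂.coevaluation' := by
  have h := @coevaluation_comp_rightAdjointMate C _ _ X X ⟨Y₂⟩ ⟨Y₁⟩ (𝟙 X)
  rw [id_whiskerRight, Category.comp_id] at h
  exact h

/-- A nondegenerate pairing stays nondegenerate after an isomorphism of its second argument. -/
theorem isNondegeneratePairing_whiskerLeft_comp {X Y Z : C} [ExactPairing Y X] (e : Z ≅ Y) :
    IsNondegeneratePairing (X ◁ e.hom ≫ ExactPairing.evaluation Y X) := by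
  let p : ExactPairing Z X := exactPairingCongrLeft e
  exact ⟨p.coevaluation', p.coevaluation_evaluation', p.evaluation_coevaluation'⟩

/-- A scalar may be moved through any morphism out of the unit object. -/
theorem scalar_comp_eq_comp_whiskerRight {Y : C} (f : 𝟙_ C ⟶ 𝟙_ C) (g : 𝟙_ C ⟶ 𝟙_ C ⊗ Y) :
    f ≫ g = g ≫ f ▷ Y := by
  obtain ⟨e, rfl⟩ : ∃ e : 𝟙_ C ⟶ Y, g = e ≫ (λ_ Y).inv := ⟨g ≫ (λ_ Y).hom, by simp⟩
  have h := whisker_exchange f e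
  rw [Category.assoc, leftUnitor_inv_naturality_assoc e, h, leftUnitor_inv_naturality e,
    unitors_inv_equal, rightUnitor_inv_naturality_assoc]

variable [RightRigidCategory C]

theorem coev_comp_mate {X Y : C} (f : X ⟶ Y) : coev Y ≫ Y ◁ fᘁ = coev X ≫ f ▷ Xᘁ :=
  coevaluation_comp_rightAdjointMate f

/-- Every morphism `1 ⟶ Y ⊗ X^∨` comes from a morphism `X ⟶ Y` by bending the input. -/
theorem exists_coev_comp_whiskerRight {X Y : C} (q : 𝟙_ C ⟶ Y ⊗ Xᘁ) :
    ∃ k : X ⟶ Y, q = coev X ≫ k ▷ Xᘁ := by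
  refine ⟨(λ_ X).inv ≫ (tensorRightHomEquiv (𝟙_ C) X (Xᘁ) Y).symm q, ?_⟩
  apply (tensorRightHomEquiv (𝟙_ C) X (Xᘁ) Y).symm.injective
  rw [coev, tensorRightHomEquiv_symm_coevaluation_comp_whiskerRight, Iso.hom_inv_id_assoc]

/-- Up to `ν_{b,a}`, the coevaluation of `a ⊗ b` is that of `b` nested inside that of `a`. -/
theorem coev_tensor_comp_dualTensor_inv (a b : C) :
    coev (a ⊗ b) ≫ (a ⊗ b) ◁ (dualTensor b a).inv =
      coev a ≫ ((ρ_ a).inv ≫ a ◁ coev b ≫ (α_ a b (bᘁ)).inv) ▷ aᘁ ≫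
        (α_ (a ⊗ b) (bᘁ) (aᘁ)).hom := by
  refine (coevaluation_comp_rightDualIso_hom _ _).trans ?_
  change _ ⊗≫ _ ⊗≫ _ = _
  simp only [coev]
  monoidal

instance isIso_coev_unit : IsIso (coev (𝟙_ C)) := by
  have h : coev (𝟙_ C) = (ρ_ _).inv ≫ 𝟙_ C ◁ (rightDualIso exactPairingUnit
      (RightRigidCategory.rightDual (𝟙_ C)).exact).hom :=
    (coevaluation_comp_rightDualIso_hom exactPairingUnit
      (RightRigidCategory.rightDual (𝟙_ C)).exact).symm
  rw [h]
  infer_instance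

end Duals

/-! ### Traces for a unitary dual functor -/

section Trace

set_option linter.unusedSectionVars false

variable {C : Type u} [Category.{v} C] [Preadditive C] [Linear ℂ C]
    [MonoidalCategory C] [MonoidalPreadditive C] [MonoidalLinear ℂ C] [DaggerCategory C]

theorem IsUnitary.dag_isUnitary {X Y : C} {f : X ⟶ Y} (h : IsUnitary f) : IsUnitary (dag f) := by
  rw [IsUnitary, dag_dag]
  exact ⟨h.2, h.1⟩

theorem eq_zero_of_comp_dag [CStarCategory C] {X Y : C} {f : X ⟶ Y} (h : f ≫ dag f = 0) :
    f = 0 := by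
  obtain ⟨N⟩ := CStarCategory.nonempty_norm (C := C)
  have hN := N.norm_comp_dag f
  rw [h, map_zero, eq_comm, sq_eq_zero_iff] at hN
  exact (map_eq_zero_iff_eq_zero (N.norm X Y)).1 hN

/-- Morphisms into an object `Y` which agree after precomposition with all morphisms from `Y` are
equal: their difference `d` satisfies `d† ≫ d = 0`. -/
theorem eq_of_forall_comp_eq [CStarCategory C] {X Y : C} {f g : X ⟶ Y}
    (h : ∀ q : Y ⟶ X, q ≫ f = q ≫ g) : f = g := by
  have h0 : dag (f - g) = 0 := by
    apply eq_zero_of_comp_dag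
    rw [dag_dag, Preadditive.comp_sub, h, sub_self]
  have h1 : dag (0 : Y ⟶ X) = 0 := by
    simpa using CStarCategory.dag_smul (0 : ℂ) (0 : Y ⟶ X)
  rw [← sub_eq_zero, ← dag_dag (f - g), h0, h1]

variable [RightRigidCategory C] [UnitaryMultitensorCategory C]

/-- The right trace of a unitary dual functor is tracial. -/
theorem rightTrace_comp_comm {X Y : C} (f : X ⟶ Y) (g : Y ⟶ X) :
    rightTrace (f ≫ g) = rightTrace (g ≫ f) := by
  have hg : g ▷ Xᘁ ≫ dag (coev X) = Y ◁ gᘁ ≫ dag (coev Y) := by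
    have h := congrArg dag (coev_comp_mate (dag g))
    rw [dag_comp, dag_comp, dag_whiskerLeft, dag_whiskerRight,
      UnitaryMultitensorCategory.dag_mate, dag_dag] at h
    exact h.symm
  rw [rightTrace, comp_whiskerRight, Category.assoc, hg, ← whisker_exchange_assoc,
    ← Category.assoc, coev_comp_mate, Category.assoc, rightTrace, comp_whiskerRight,
    Category.assoc]

theorem IsUnitary.comp_dag_comp {X Y Z : C} {e : Y ⟶ Z} (h : IsUnitary e) (f : X ⟶ Y) :
    (f ≫ e) ≫ dag (f ≫ e) = f ≫ dag f := by
  rw [dag_comp, Category.assoc, ← Category.assoc e, h.1, Category.id_comp]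

theorem IsUnitary.whiskerLeft {Y Z : C} {e : Y ⟶ Z} (h : IsUnitary e) (X : C) :
    IsUnitary (X ◁ e) := by
  rw [IsUnitary, dag_whiskerLeft, ← MonoidalCategory.whiskerLeft_comp,
    ← MonoidalCategory.whiskerLeft_comp, h.1, h.2]
  simp

theorem IsUnitary.isUnitary_inv {X Y : C} (e : X ≅ Y) (h : IsUnitary e.hom) :
    IsUnitary e.inv := by
  rw [← IsUnitary.dag_eq e h]
  exact h.dag_isUnitary

/-- Unitarity of the canonical isomorphisms `a^∨ ⊗ b^∨ ≅ (b ⊗ a)^∨` makes the dimension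
multiplicative, up to the position of the scalar `dim b`. -/
theorem rightTrace_id_tensor (a b : C) :
    rightTrace (𝟙 (a ⊗ b)) = rightTrace ((ρ_ a).inv ≫ a ◁ rightTrace (𝟙 b) ≫ (ρ_ a).hom) := by
  have h := (IsUnitary.isUnitary_inv _
    (UnitaryMultitensorCategory.unitary_dualTensor b a)).whiskerLeft (a ⊗ b)
  have h1 := h.comp_dag_comp (coev (a ⊗ b))
  have hα := SemisimpleTensorCStarCategory.unitary_associator (a ⊗ b) (bᘁ) (aᘁ)
  have hα' := IsUnitary.isUnitary_inv _
    (SemisimpleTensorCStarCategory.unitary_associator a b (bᘁ))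
  rw [coev_tensor_comp_dualTensor_inv, ← Category.assoc, hα.comp_dag_comp, dag_comp,
    dag_whiskerRight, Category.assoc, ← comp_whiskerRight_assoc, ← Category.assoc (ρ_ a).inv,
    hα'.comp_dag_comp, dag_comp, dag_whiskerLeft, dag_inv _ (SemisimpleTensorCStarCategory.unitary_rightUnitor a),
    Category.assoc, ← MonoidalCategory.whiskerLeft_comp_assoc] at h1
  simpa only [rightTrace, id_whiskerRight, Category.id_comp] using h1.symm

/-- For a unitary dual functor the unit object has dimension one. -/
theorem coev_unit_comp_dag : coev (𝟙_ C) ≫ dag (coev (𝟙_ C)) = 𝟙 (𝟙_ C) := by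
  -- The dimension `s` of the unit object is an invertible idempotent.
  set s := coev (𝟙_ C) ≫ dag (coev (𝟙_ C)) with hs
  have hid : rightTrace (𝟙 (𝟙_ C)) = s := by
    rw [rightTrace, id_whiskerRight, Category.id_comp]
  have hss : s ≫ s = s := by
    have h := rightTrace_id_tensor (𝟙_ C) (𝟙_ C)
    rw [← (λ_ (𝟙_ C)).hom_inv_id, rightTrace_comp_comm, Iso.inv_hom_id, hid,
      ← unitors_equal, ← unitors_inv_equal, leftUnitor_naturality, Iso.inv_hom_id_assoc,
      rightTrace, ← Category.assoc, ← scalar_comp_eq_comp_whiskerRight, Category.assoc] at h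
    exact h.symm
  have : IsIso (dag (coev (𝟙_ C))) :=
    ⟨dag (inv (coev (𝟙_ C))), by rw [← dag_comp, IsIso.inv_hom_id, dag_id],
      by rw [← dag_comp, IsIso.hom_inv_id, dag_id]⟩
  have : IsIso s := by rw [hs]; infer_instance
  rw [← cancel_epi s, hss, Category.comp_id]

/-- On endomorphisms of the unit object the right trace is the identity. -/
theorem rightTrace_unit (f : 𝟙_ C ⟶ 𝟙_ C) : rightTrace f = f := by
  rw [rightTrace, ← Category.assoc, ← scalar_comp_eq_comp_whiskerRight, Category.assoc,
    coev_unit_comp_dag, Category.comp_id]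

end Trace

/-! ### The right adjoint of the action -/

section Module

open Functor.LaxMonoidal Functor.OplaxMonoidal

variable {V : Type u₁} [Category.{v₁} V] [MonoidalCategory V] [RightRigidCategory V]
  {C : Type u₂} [Category.{v₂} C] [MonoidalCategory C] [RightRigidCategory C]

/-- The canonical isomorphism `F(c^∨) ≅ F(c)^∨` carries the image of `coev_c` to `coev_{F(c)}`. -/
theorem map_coev_comp_chi (F : V ⥤ C) [F.Monoidal] (c : V) :
    ε F ≫ F.map (coev c) ≫ δ F c (cᘁ) ≫ F.obj c ◁ (chi F c).hom = coev (F.obj c) := by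
  have h := coevaluation_comp_rightDualIso_hom (mapExactPairing F c (cᘁ))
    (RightRigidCategory.rightDual (F.obj c)).exact
  change (ε F ≫ F.map (coev c) ≫ δ F c (cᘁ)) ≫ F.obj c ◁ (chi F c).hom = coev (F.obj c) at h
  simpa only [Category.assoc] using h

end Module

section Module

set_option linter.unusedSectionVars false

open Functor.LaxMonoidal Functor.OplaxMonoidal

variable {V : Type u₁} [Category.{v₁} V] [Preadditive V] [Linear ℂ V] [MonoidalCategory V]
  [MonoidalPreadditive V] [MonoidalLinear ℂ V] [BraidedCategory V] [DaggerCategory V]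
  [RightRigidCategory V] [UnitaryMultitensorCategory V] [SimpleUnit V]
  {C : Type u₂} [Category.{v₂} C] [Preadditive C] [Linear ℂ C] [MonoidalCategory C]
  [MonoidalPreadditive C] [MonoidalLinear ℂ C] [DaggerCategory C]
  [RightRigidCategory C] [UnitaryMultitensorCategory C]

theorem unitScalar_injective : Function.Injective (unitScalar V) :=
  (LinearEquiv.ofBijective _ (SimpleUnit.bijective (C := V))).symm.injective

variable (M : ModuleStructure V C)

theorem ModuleStructure.dag_η : dag (η M.Φ) = ε M.Φ := by
  have h : IsUnitary (ε M.Φ) := by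
    have h1 : ε M.Φ = (ε M.action).f := by
      -- The forgetful functor from the centre is strictly unital.
      change 𝟙 _ ≫ _ = _
      exact Category.id_comp _
    rw [h1]
    exact M.unitary_unit
  exact dag_inv (Functor.Monoidal.εIso M.Φ) h

variable {M} {T : C ⥤ V} (adj : M.Φ ⊣ T)

/-- The mate of a morphism followed by the multiplication; the mate of the identity of `T(c)` is the
counit at `c`, written here with source `Φ(T(c))`. -/
theorem homEquiv_symm_comp_traceMul {x : V} {c d e : C} (a : x ⟶ T.obj c ⊗ T.obj d)
    (g : c ⊗ d ⟶ e) :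
    (adj.homEquiv x e).symm (a ≫ traceMul M adj c d ≫ T.map g) =
      M.Φ.map a ≫ δ M.Φ _ _ ≫
        ((adj.homEquiv _ c).symm (𝟙 _) ⊗ₘ (adj.homEquiv _ d).symm (𝟙 _)) ≫ g := by
  rw [Adjunction.homEquiv_naturality_left_symm, Adjunction.homEquiv_naturality_right_symm]
  have h : (adj.homEquiv _ _).symm (traceMul M adj c d) =
      δ M.Φ _ _ ≫ ((adj.homEquiv _ c).symm (𝟙 _) ⊗ₘ (adj.homEquiv _ d).symm (𝟙 _)) := by
    rw [adj.homEquiv_symm_id, adj.homEquiv_symm_id]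
    exact (adj.homEquiv _ _).symm_apply_apply _
  rw [h, Category.assoc]

/-- The unit map `i` of the right adjoint is the mate of a unitary, so pairing with `i†` is carried
by the adjunction to the state on `End(1_C)`. -/
theorem unitScalar_comp_dag_traceUnit (hadj : IsUnitaryAdjunction M adj)
    (q : 𝟙_ V ⟶ T.obj (𝟙_ C)) :
    unitScalar V (q ≫ dag (traceUnit M adj)) =
      M.state (ε M.Φ ≫ (adj.homEquiv _ _).symm q) := by
  have h := hadj (𝟙_ V) (𝟙_ C) ((adj.homEquiv _ _).symm q) (η M.Φ)
  rw [Equiv.apply_symm_apply, homInner, homInner, rightTrace_comp_comm _ (dag (η M.Φ)),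
    rightTrace_unit, M.dag_η, rightTrace_unit] at h
  exact h

/-- Under the adjunction, the pairing obtained from the lax monoidal and involutive structures of
the right adjoint computes the same inner products with the counit as the evaluation
`coev_{T(c)}†`. -/
theorem unit_comp_homEquiv_symm_eq_rightTrace {c : C} (k : T.obj c ⟶ T.obj c) :
    ε M.Φ ≫ (adj.homEquiv _ _).symm ((coev (T.obj c) ≫ k ▷ (T.obj c)ᘁ ≫
        T.obj c ◁ (traceChi M adj c).inv) ≫ traceMul M adj c (cᘁ) ≫ T.map (dag (coev c))) =
      rightTrace ((adj.homEquiv _ _).symm k ≫ dag ((adj.homEquiv _ c).symm (𝟙 _))) := by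
  have hk : (adj.homEquiv _ c).symm k = M.Φ.map k ≫ (adj.homEquiv _ c).symm (𝟙 _) := by
    rw [← adj.homEquiv_naturality_left_symm, Category.comp_id]
  have hχ : M.Φ.map (traceChi M adj c).inv ≫ (adj.homEquiv _ (cᘁ)).symm (𝟙 _) =
      (chi M.Φ (T.obj c)).hom ≫ barMap ((adj.homEquiv _ c).symm (𝟙 _)) := by
    rw [← adj.homEquiv_naturality_left_symm, Category.comp_id, adj.homEquiv_symm_id]
    exact (adj.homEquiv _ _).symm_apply_apply _
  rw [hk, homEquiv_symm_comp_traceMul]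
  generalize (adj.homEquiv _ c).symm (𝟙 (T.obj c)) = e at hχ ⊢
  have he : c ◁ barMap e ≫ dag (coev c) = dag e ▷ _ ≫ dag (coev (M.Φ.obj (T.obj c))) := by
    rw [barMap, ← UnitaryMultitensorCategory.dag_mate, ← dag_whiskerLeft, ← dag_whiskerRight,
      ← dag_comp, ← dag_comp, coev_comp_mate]
  rw [Functor.map_comp, Functor.map_comp, Category.assoc,
    Category.assoc, ← δ_natural_right_assoc, ← δ_natural_left_assoc, tensorHom_def',
    Category.assoc, ← MonoidalCategory.whiskerLeft_comp_assoc, hχ,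
    MonoidalCategory.whiskerLeft_comp, Category.assoc, whisker_exchange_assoc, he,
    ← whisker_exchange_assoc, ← comp_whiskerRight_assoc]
  have hc := map_coev_comp_chi M.Φ (T.obj c)
  rw [rightTrace, comp_whiskerRight _ (dag e), ← hc]
  simp only [Category.assoc]

end Module

end UnitaryModule

open UnitaryModule in
theorem mainTheorem4
    {V : Type u₁} [Category.{v₁} V] [Preadditive V] [Linear ℂ V] [MonoidalCategory V]
    [MonoidalPreadditive V] [MonoidalLinear ℂ V] [BraidedCategory V]
    [UnitaryModule.DaggerCategory V] [RightRigidCategory V]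
    [UnitaryModule.UnitaryMultitensorCategory V] [UnitaryModule.SimpleUnit V]
    {C : Type u₂} [Category.{v₂} C] [Preadditive C] [Linear ℂ C] [MonoidalCategory C]
    [MonoidalPreadditive C] [MonoidalLinear ℂ C]
    [UnitaryModule.DaggerCategory C] [RightRigidCategory C]
    [UnitaryModule.UnitaryMultitensorCategory C]
    (M : UnitaryModule.ModuleStructure V C)
    {T : C ⥤ V} (adj : M.Φ ⊣ T) (hadj : UnitaryModule.IsUnitaryAdjunction M adj) (c : C) :
    UnitaryModule.DaggerCategory.dag (UnitaryModule.coev (T.obj c)) =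
        T.obj c ◁ (UnitaryModule.traceChi M adj c).inv ≫
          UnitaryModule.traceMul M adj c (cᘁ) ≫
          T.map (UnitaryModule.DaggerCategory.dag (UnitaryModule.coev c)) ≫
          UnitaryModule.DaggerCategory.dag (UnitaryModule.traceUnit M adj) ∧
      UnitaryModule.IsNondegeneratePairing
        (UnitaryModule.traceMul M adj c (cᘁ) ≫
          T.map (UnitaryModule.DaggerCategory.dag (UnitaryModule.coev c)) ≫
          UnitaryModule.DaggerCategory.dag (UnitaryModule.traceUnit M adj)) := by
  have hcoev : DaggerCategory.dag (coev (T.obj c)) =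
      T.obj c ◁ (traceChi M adj c).inv ≫ traceMul M adj c (cᘁ) ≫
        T.map (DaggerCategory.dag (coev c)) ≫ DaggerCategory.dag (traceUnit M adj) := by
    -- Test both sides on all `1 ⟶ T(c) ⊗ T(c)^∨`, that is, on all endomorphisms `k` of `T(c)`:
    -- the two scalars are the inner products of `k` with `𝟙` in `V`, and of their mates in `C`.
    refine eq_of_forall_comp_eq fun q => unitScalar_injective ?_
    obtain ⟨k, rfl⟩ := exists_coev_comp_whiskerRight q
    have h := hadj _ c ((adj.homEquiv _ _).symm k) ((adj.homEquiv _ _).symm (𝟙 _))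
    rw [Equiv.apply_symm_apply, Equiv.apply_symm_apply, homInner, homInner,
      DaggerCategory.dag_id, Category.comp_id, ← unit_comp_homEquiv_symm_eq_rightTrace,
      ← unitScalar_comp_dag_traceUnit adj hadj] at h
    simpa only [rightTrace, Category.assoc] using h
  refine ⟨hcoev, ?_⟩
  let := dagExactPairing (T.obj c)
  have h := isNondegeneratePairing_whiskerLeft_comp (X := T.obj c) (traceChi M adj c)
  have h1 : ExactPairing.evaluation ((T.obj c)ᘁ) (T.obj c) =
      DaggerCategory.dag (coev (T.obj c)) := rfl
  rwa [h1, hcoev, ← MonoidalCategory.whiskerLeft_comp_assoc, Iso.hom_inv_id,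
    MonoidalCategory.whiskerLeft_id, Category.id_comp] at h
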